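/- All spaces are over the complex field. For a Hilbert space $H$, let $B(H)$ be the algebra of all bounded linear operators on $H$ and $A^*$ the Hilbert space adjoint of $A\in B(H)$. A (not necessarily unital or closed) subalgebra of $B(H)$ is called a standard operator algebra if it contains every bounded linear operator of finite rank. Let $H,K$ be Hilbert spaces with $\dim H>1$, and let $\mathcal A\subset B(H)$, $\mathcal B\subset B(K)$ be standard operator algebras which are closed under taking adjoints. Suppose that $\phi:\mathcal A\to\mathcal B$ is a bijective map (no linearity, additivity or continuity is assumed) such that $$\phi(A^*)=\phi(A)^*,\qquad \phi\left(\tfrac12(AB+BA)\right)=\tfrac12\left(\phi(A)\phi(B)+\phi(B)\phi(A)\right)$$ for all $A,B\in\mathcal A$. Then at least one of the following holds: (i) there is a unitary operator $U:H\to K$ such that $\phi(A)=UAU^*$ for all $A\in\mathcal A$; (ii) there is an antiunitary operator $U:H\to K$ such that $\phi(A)=UAU^*$ for all $A\in\mathcal A$; (iii) there is a unitary operator $U:H\to K$ such that $\phi(A)=UA^*U^*$ for all $A\in\mathcal A$; (iv) there is an antiunitary operator $U:H\to K$ such that $\phi(A)=UA^*U^*$ for all $A\in\mathcal A$. Here a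 unitary (respectively antiunitary) operator $U:H\to K$ is a surjective linear (respectively conjugate-linear) isometry, and $U^*$ is its adjoint, which equals $U^{-1}$. -/

import Mathlib

/-- A (not necessarily unital, not necessarily closed) subalgebra of `B(X)` is a standard operator
algebra if it contains every bounded linear operator of finite rank. -/
def IsStandardOperatorAlgebra {X : Type*} [NormedAddCommGroup X] [NormedSpace ℂ X]
    (𝒜 : NonUnitalSubalgebra ℂ (X →L[ℂ] X)) : Prop :=
  ∀ T : X →L[ℂ] X, FiniteDimensional ℂ (LinearMap.range (T : X →ₗ[ℂ] X)) → T ∈ 𝒜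

/-- Unitary operators `H → K`: surjective linear isometries. -/
abbrev UnitaryOperator (H K : Type*) [NormedAddCommGroup H] [InnerProductSpace ℂ H]
    [NormedAddCommGroup K] [InnerProductSpace ℂ K] : Type _ :=
  H ≃ₗᵢ[ℂ] K

/-- Antiunitary operators `H → K`: surjective conjugate-linear isometries. -/
abbrev AntiunitaryOperator (H K : Type*) [NormedAddCommGroup H] [InnerProductSpace ℂ H]
    [NormedAddCommGroup K] [InnerProductSpace ℂ K] : Type _ :=
  H ≃ₛₗᵢ[starRingEnd ℂ] K

/-- The adjoint `U*` of an antiunitary operator, which is its inverse; the defining relation of the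
adjoint of a conjugate-linear operator is `AntiunitaryOperator.inner_adjoint` below. -/
def AntiunitaryOperator.adjoint {H K : Type*} [NormedAddCommGroup H] [InnerProductSpace ℂ H]
    [NormedAddCommGroup K] [InnerProductSpace ℂ K] (U : AntiunitaryOperator H K) :
    K →SL[starRingEnd ℂ] H :=
  (U.symm.toContinuousLinearEquiv : K →SL[starRingEnd ℂ] H)

/-- An antiunitary operator reverses inner products. -/
theorem AntiunitaryOperator.inner_map_map {H K : Type*} [NormedAddCommGroup H]
    [InnerProductSpace ℂ H] [NormedAddCommGroup K] [InnerProductSpace ℂ K]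
    (U : AntiunitaryOperator H K) (x y : H) : inner ℂ (U x) (U y) = inner ℂ y x := by
  rw [inner_eq_sum_norm_sq_div_four, inner_eq_sum_norm_sq_div_four y x]
  have h1 : ‖U x + U y‖ = ‖y + x‖ := by rw [← map_add, U.norm_map, add_comm]
  have h2 : ‖U x - U y‖ = ‖y - x‖ := by rw [← map_sub, U.norm_map, norm_sub_rev]
  have e : (RCLike.I : ℂ) = Complex.I := rfl
  have h3 : ‖U x - (RCLike.I : ℂ) • U y‖ = ‖y - (RCLike.I : ℂ) • x‖ := by
    have : U x - (RCLike.I : ℂ) • U y = U ((RCLike.I : ℂ) • (y - (RCLike.I : ℂ) • x)) := by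
      rw [smul_sub, smul_smul, map_sub, map_smulₛₗ, map_smulₛₗ, e]
      simp
      abel
    rw [this, U.norm_map, norm_smul, e]
    simp
  have h4 : ‖U x + (RCLike.I : ℂ) • U y‖ = ‖y + (RCLike.I : ℂ) • x‖ := by
    have : U x + (RCLike.I : ℂ) • U y = U (-(RCLike.I : ℂ) • (y + (RCLike.I : ℂ) • x)) := by
      rw [smul_add, smul_smul, map_add, map_smulₛₗ, map_smulₛₗ, e]
      simp
      abel
    rw [this, U.norm_map, norm_smul, e]
    simp
  rw [h1, h2, h3, h4]

/-- The relation `⟨U x, y⟩ = ⟨U* y, x⟩` that characterizes the adjoint of a conjugate-linear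
operator. -/
theorem AntiunitaryOperator.inner_adjoint {H K : Type*} [NormedAddCommGroup H]
    [InnerProductSpace ℂ H] [NormedAddCommGroup K] [InnerProductSpace ℂ K]
    (U : AntiunitaryOperator H K) (x : H) (y : K) :
    inner ℂ (U x) y = inner ℂ (AntiunitaryOperator.adjoint U y) x := by
  have h := AntiunitaryOperator.inner_map_map U x (U.symm y)
  rw [U.apply_symm_apply] at h
  exact h

/-- The bounded linear operator `U T U*` on `K`, for `U : H → K` unitary and `T ∈ B(H)`. -/
noncomputable def unitaryConj {H K : Type*} [NormedAddCommGroup H] [InnerProductSpace ℂ H]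
    [CompleteSpace H] [NormedAddCommGroup K] [InnerProductSpace ℂ K] [CompleteSpace K]
    (U : UnitaryOperator H K) (T : H →L[ℂ] H) : K →L[ℂ] K :=
  let V : H →L[ℂ] K := U.toContinuousLinearEquiv
  V.comp (T.comp (ContinuousLinearMap.adjoint V))

/-- The bounded linear operator `U T U*` on `K`, for `U : H → K` antiunitary and `T ∈ B(H)`. -/
def antiunitaryConj {H K : Type*} [NormedAddCommGroup H] [InnerProductSpace ℂ H]
    [NormedAddCommGroup K] [InnerProductSpace ℂ K]
    (U : AntiunitaryOperator H K) (T : H →L[ℂ] H) : K →L[ℂ] K :=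
  (U.toContinuousLinearEquiv : H →SL[starRingEnd ℂ] K).comp
    (T.comp (AntiunitaryOperator.adjoint U))

/-! The Jordan product detects the order and orthogonality of projections, so `φ` sends rank-one
projections to rank-one projections and keeps them orthogonal (`exists_mapsLine`, `inner_eq_zero`).
On multiples of rank-one projections it acts by a single function `σ` on the scalars, which is
multiplicative and commutes with conjugation (`exists_actsOnScalars`).

Since `dim H > 1`, each unit vector `x` has an orthogonal unit vector `y`. The Jordan product of `S
= x ⊗ y* + y ⊗ x*` with a diagonal operator averages the two diagonal entries, which makes `σ`
additive (`scalar_add`); hence `σ` is the identity or conjugation. A nested Jordan product recovers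
`⟨x, Ax⟩` as a coefficient of `S`, so `φ` transports the quadratic form of every operator through
`σ` (`inner_map_apply`). As a bounded operator is determined by its quadratic form, `φ` is additive.

For `y ⊥ x`, the image of `y ⊗ x*` squares to zero and has the form `u ⊗ x'*` or `x' ⊗ v*`, with the
same alternative for all `y` (`map_rankOne_type`). Composing with the adjoint reduces the second
case to the first. Then `U y = φ(y ⊗ x*) x'` is a surjective isometry, linear or conjugate-linear
according to `σ`, and it carries each line to the line prescribed by `φ`. Comparing quadratic forms
gives `φ(A) = U A U*`. -/

open InnerProductSpace

/-! ### Jordan product identities and Peirce relations -/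

section JordanProduct

variable {R : Type*} [Ring R] [Algebra ℂ R]

/-- The Jordan product `½(ab + ba)`. -/
noncomputable def jmul (a b : R) : R := (1 / 2 : ℂ) • (a * b + b * a)

theorem jmul_comm (a b : R) : jmul a b = jmul b a := by
  rw [jmul, jmul, add_comm]

theorem jmul_add (a b c : R) : jmul a (b + c) = jmul a b + jmul a c := by
  simp only [jmul, mul_add, add_mul, smul_add]
  abel

theorem add_jmul (a b c : R) : jmul (a + b) c = jmul a c + jmul b c := by
  rw [jmul_comm, jmul_add, jmul_comm c, jmul_comm c]

theorem jmul_smul (z : ℂ) (a b : R) : jmul a (z • b) = z • jmul a b := by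
  simp only [jmul, mul_smul_comm, smul_mul_assoc, smul_add, smul_comm z]

theorem smul_jmul (z : ℂ) (a b : R) : jmul (z • a) b = z • jmul a b := by
  rw [jmul_comm, jmul_smul, jmul_comm]

theorem jmul_zero (a : R) : jmul a 0 = 0 := by simp [jmul]

theorem zero_jmul (a : R) : jmul 0 a = 0 := by simp [jmul]

theorem two_smul_jmul (a b : R) : (2 : ℂ) • jmul a b = a * b + b * a := by
  rw [jmul, smul_smul]; norm_num

theorem jmul_self (a : R) : jmul a a = a * a := by
  rw [jmul, ← two_smul ℂ (a * a), smul_smul]; norm_num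

theorem jmul_eq_of_mul_eq {p a : R} (h₁ : p * a = a) (h₂ : a * p = a) : jmul p a = a := by
  rw [jmul, h₁, h₂, ← two_smul ℂ a, smul_smul]; norm_num

/-- Multiplying `pa + ap = 2a` by `p` on either side gives `pa = pap = ap`. Thus the order on
projections can be read off the Jordan product. -/
theorem mul_eq_of_jmul_eq {p a : R} (hp : p * p = p) (h : jmul p a = a) :
    p * a = a ∧ a * p = a := by
  have h₁ : p * a + a * p = a + a := by
    rw [← two_smul_jmul, h, two_smul]
  have h₂ : p * a + p * a * p = p * a + p * a := by
    simpa only [mul_add, ← mul_assoc, hp] using congrArg (p * ·) h₁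
  have h₃ : p * a * p + a * p = a * p + a * p := by
    simpa only [add_mul, mul_assoc, hp] using congrArg (· * p) h₁
  have h₄ : p * a = a * p := by
    rw [← add_left_cancel h₂, ← add_right_cancel h₃]
  have h₅ : a * p = a := by
    have : (2 : ℂ) • (a * p) = (2 : ℂ) • a := by
      rw [two_smul, two_smul, ← h₁, h₄]
    exact smul_right_injective R (two_ne_zero (α := ℂ)) this
  exact ⟨h₄.trans h₅, h₅⟩

theorem mul_eq_zero_of_jmul_eq_zero {p a : R} (hp : p * p = p) (h : jmul p a = 0) :
    p * a = 0 ∧ a * p = 0 := by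
  have h₁ : p * a + a * p = 0 := by
    rw [← two_smul_jmul, h, smul_zero]
  have h₂ : p * a + p * a * p = 0 := by
    simpa only [mul_add, ← mul_assoc, hp, mul_zero] using congrArg (p * ·) h₁
  have h₃ : p * a * p + a * p = 0 := by
    simpa only [add_mul, mul_assoc, hp, zero_mul] using congrArg (· * p) h₁
  have h₄ : p * a = a * p := by
    rw [eq_neg_of_add_eq_zero_left h₂, eq_neg_of_add_eq_zero_right h₃]
  have h₅ : a * p = 0 := by
    have : (2 : ℂ) • (a * p) = 0 := by
      rw [two_smul, ← h₁, h₄]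
    simpa using this
  exact ⟨h₄.trans h₅, h₅⟩

theorem mul_add_mul_eq_of_jmul_eq_half {s p : R} (h : jmul s p = (1 / 2 : ℂ) • s) :
    s * p + p * s = s := by
  rw [← two_smul_jmul, h, smul_smul]; norm_num

/-- The hypotheses on `s` say that it has only the corners `psq` and `qsp`. Since `t = ap + pa` has
`ptp = 2cp` and `qtq = 0`, both off-diagonal corners of `st + ts` are `2c` times those of `s`. The
diagonal entry `c` is thus expressed by Jordan products alone. -/
theorem jmul_offDiagonal {p q s a : R} {c : ℂ} (hp : p * p = p)
    (hpq : p * q = 0) (hqp : q * p = 0) (hsp : s * p + p * s = s) (hsq : s * q + q * s = s)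
    (ha : p * a * p = c • p) :
    jmul q (jmul p (jmul s (jmul a p))) = (c / 8) • s := by
  have hps : p * s = p * s * q := by
    nth_rw 1 [← hsq]
    rw [mul_add, ← mul_assoc, ← mul_assoc, hpq, zero_mul, add_zero]
  have hs : s * p = q * s * p := by
    nth_rw 1 [← hsq]
    rw [add_mul, mul_assoc s, hqp, mul_zero, zero_add]
  set t := a * p + p * a with ht
  have hptp : p * t * p = (2 * c) • p := by
    have : p * t * p = p * a * p + p * a * p := by
      rw [ht, mul_add, add_mul, ← mul_assoc, ← mul_assoc, hp, mul_assoc (p * a) p p, hp]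
    rw [this, ha, ← add_smul, two_mul]
  have hqtq : q * t * q = 0 := by
    rw [ht, mul_add, add_mul, mul_assoc, mul_assoc a, hpq, ← mul_assoc q p, hqp]
    simp
  have e₁ : p * (s * t + t * s) * q = (2 * c) • (p * s) := by
    have h₁ : p * (s * t) * q = 0 := by
      rw [← mul_assoc, hps, mul_assoc, mul_assoc, ← mul_assoc q, hqtq, mul_zero]
    have h₃ : p * (t * s) * q = p * t * p * s := by
      have h₄ : p * t * s * q = p * t * (s * q) := by rw [mul_assoc]
      rw [← mul_assoc, h₄]
      have h₆ : s * q = p * s := by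
        have : p * s * q + s * p * q = s * q := by rw [add_comm, ← add_mul, hsp]
        rw [mul_assoc s p q, hpq, mul_zero, add_zero, ← hps] at this
        exact this.symm
      rw [h₆, ← mul_assoc]
    rw [mul_add, add_mul, h₁, h₃, hptp, zero_add, smul_mul_assoc]
  have e₂ : q * (s * t + t * s) * p = (2 * c) • (s * p) := by
    have h₁ : q * (t * s) * p = 0 := by
      rw [mul_assoc, mul_assoc, hs, ← mul_assoc t, ← mul_assoc t, ← mul_assoc q, ← mul_assoc q,
        ← mul_assoc q, hqtq, zero_mul, zero_mul]
    have h₆ : q * s = s * p := by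
      have : q * (s * p) + q * (p * s) = q * s := by rw [← mul_add, hsp]
      rw [← mul_assoc q p, hqp, zero_mul, add_zero, ← mul_assoc, ← hs] at this
      exact this.symm
    have h₃ : q * (s * t) * p = s * (p * t * p) := by
      rw [← mul_assoc q, h₆]; simp only [mul_assoc]
    rw [mul_add, add_mul, h₁, h₃, hptp, add_zero, mul_smul_comm]
  -- Successive Jordan multiplication by orthogonal `p` and `q` extracts the off-diagonal corners.
  have e₃ : ∀ x : R, jmul q (jmul p x) = (1 / 4 : ℂ) • (p * x * q + q * x * p) := by
    intro x
    simp only [jmul, mul_smul_comm, smul_mul_assoc, ← smul_add, smul_smul]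
    congr 1
    · norm_num
    · simp only [mul_add, add_mul, ← mul_assoc, hqp]
      rw [mul_assoc x p q, hpq]; simp only [mul_zero, zero_mul]; abel
  have e₄ : jmul s (jmul a p) = (1 / 4 : ℂ) • (s * t + t * s) := by
    rw [ht]
    simp only [jmul, mul_smul_comm, smul_mul_assoc, ← smul_add, smul_smul]
    norm_num
  rw [e₃, e₄]
  simp only [mul_smul_comm, smul_mul_assoc]
  rw [e₁, e₂, ← smul_add, ← smul_add, add_comm (p * s), hsp, smul_smul, smul_smul]
  congr 1
  ring

end JordanProduct

/-! ### Rank-one operators and projections -/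

section RankOne

variable {H : Type*} [NormedAddCommGroup H] [InnerProductSpace ℂ H]

theorem rankOne_mul_rankOne (x y z w : H) :
    rankOne ℂ x y * rankOne ℂ z w = inner ℂ y z • rankOne ℂ x w := by
  ext v
  simp [smul_smul, mul_comm]

theorem mul_rankOne (A : H →L[ℂ] H) (x y : H) : A * rankOne ℂ x y = rankOne ℂ (A x) y := by
  ext v
  simp

theorem rankOne_self_mul_mul (A : H →L[ℂ] H) (x : H) :
    rankOne ℂ x x * A * rankOne ℂ x x = inner ℂ x (A x) • rankOne ℂ x x := by
  rw [mul_assoc, mul_rankOne, rankOne_mul_rankOne]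

theorem inner_self_eq_one {x : H} (hx : ‖x‖ = 1) : inner ℂ x x = 1 := by
  simp [inner_self_eq_norm_sq_to_K, hx]

theorem rankOne_self_mul_self {x : H} (hx : ‖x‖ = 1) :
    rankOne ℂ x x * rankOne ℂ x x = rankOne ℂ x x := by
  rw [rankOne_mul_rankOne, inner_self_eq_one hx, one_smul]

theorem rankOne_self_ne_zero {x : H} (hx : ‖x‖ = 1) : rankOne ℂ x x ≠ 0 := by
  have : x ≠ 0 := by rintro rfl; simp at hx
  exact rankOne_ne_zero this this

theorem star_rankOne [CompleteSpace H] (x y : H) : star (rankOne ℂ x y) = rankOne ℂ y x := by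
  rw [ContinuousLinearMap.star_eq_adjoint, adjoint_rankOne]

theorem jmul_rankOne_smul_eq {x : H} (hx : ‖x‖ = 1) (c : ℂ) :
    jmul (rankOne ℂ x x) (c • rankOne ℂ x x) = c • rankOne ℂ x x := by
  rw [jmul_smul, jmul_self, rankOne_self_mul_self hx]

/-- The Peirce `1`-space of a rank-one projection is one-dimensional. -/
theorem eq_smul_rankOne_of_jmul_eq {x : H} (hx : ‖x‖ = 1) {T : H →L[ℂ] H}
    (h : jmul (rankOne ℂ x x) T = T) : T = inner ℂ x (T x) • rankOne ℂ x x := by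
  obtain ⟨h₁, h₂⟩ := mul_eq_of_jmul_eq (rankOne_self_mul_self hx) h
  rw [← rankOne_self_mul_mul, h₁, h₂]

theorem exists_unit_rankOne_jmul_eq {P : H →L[ℂ] H} [CompleteSpace H] (h0 : P ≠ 0)
    (hP : P * P = P) (hs : star P = P) :
    ∃ x : H, ‖x‖ = 1 ∧ jmul P (rankOne ℂ x x) = rankOne ℂ x x := by
  obtain ⟨v, hv⟩ : ∃ v, P v ≠ 0 := by
    by_contra! h
    exact h0 (ContinuousLinearMap.ext h)
  set c : ℂ := ((‖P v‖⁻¹ : ℝ) : ℂ)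
  have hx : ‖c • P v‖ = 1 := by
    rw [norm_smul, Complex.norm_real, norm_inv, norm_norm, inv_mul_cancel₀ (norm_ne_zero_iff.2 hv)]
  have hPx : P (c • P v) = c • P v := by
    rw [map_smul, ← mul_apply_eq_comp, hP]
  refine ⟨c • P v, hx, ?_⟩
  have h₁ : P * rankOne ℂ (c • P v) (c • P v) = rankOne ℂ (c • P v) (c • P v) := by
    rw [mul_rankOne, hPx]
  refine jmul_eq_of_mul_eq h₁ ?_
  have := congrArg star h₁
  rwa [star_mul, star_rankOne, hs] at this

theorem exists_unit_orthogonal (hH : 1 < Module.rank ℂ H) (x : H) :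
    ∃ y : H, ‖y‖ = 1 ∧ inner ℂ x y = 0 := by
  obtain ⟨y, hy, hy0⟩ : ∃ y, inner ℂ x y = 0 ∧ y ≠ 0 := by
    by_contra! h
    have htop : (ℂ ∙ x) = ⊤ := by
      rw [← Submodule.orthogonal_eq_bot_iff, Submodule.eq_bot_iff]
      intro y hy
      exact h y (Submodule.mem_orthogonal_singleton_iff_inner_right.1 hy)
    have := rank_submodule_le_one_iff' (K := ℂ) (ℂ ∙ x) |>.2 ⟨x, le_rfl⟩
    rw [htop, rank_top] at this
    exact absurd hH (not_lt.2 this)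
  refine ⟨((‖y‖⁻¹ : ℝ) : ℂ) • y, ?_, ?_⟩
  · rw [norm_smul, Complex.norm_real, norm_inv, norm_norm, inv_mul_cancel₀ (norm_ne_zero_iff.2 hy0)]
  · rw [inner_smul_right, hy, mul_zero]

end RankOne

/-! ### Action on rank-one projections and their multiples -/

section JordanStarIso

variable {H K : Type*} [NormedAddCommGroup H] [InnerProductSpace ℂ H] [CompleteSpace H]
  [NormedAddCommGroup K] [InnerProductSpace ℂ K] [CompleteSpace K]

/-- `f` restricts to a bijection between the self-adjoint standard operator algebras `𝒜` and `ℬ`,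
with inverse `g`, which preserves adjoints and Jordan products. -/
structure IsJordanStarIso (𝒜 : NonUnitalStarSubalgebra ℂ (H →L[ℂ] H))
    (ℬ : NonUnitalStarSubalgebra ℂ (K →L[ℂ] K))
    (f : (H →L[ℂ] H) → (K →L[ℂ] K)) (g : (K →L[ℂ] K) → (H →L[ℂ] H)) : Prop where
  rankOne_mem : ∀ x y : H, rankOne ℂ x y ∈ 𝒜
  rankOne_mem' : ∀ x y : K, rankOne ℂ x y ∈ ℬ
  map_mem : ∀ A ∈ 𝒜, f A ∈ ℬ
  inv_mem : ∀ B ∈ ℬ, g B ∈ 𝒜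
  left_inv : ∀ A ∈ 𝒜, g (f A) = A
  right_inv : ∀ B ∈ ℬ, f (g B) = B
  map_star : ∀ A ∈ 𝒜, f (star A) = star (f A)
  map_jmul : ∀ A ∈ 𝒜, ∀ B ∈ 𝒜, f (jmul A B) = jmul (f A) (f B)

/-- `x` and `x'` are unit vectors and `f` maps the projection onto `ℂx` to the one onto `ℂx'`. -/
structure MapsLine (f : (H →L[ℂ] H) → (K →L[ℂ] K)) (x : H) (x' : K) : Prop where
  norm_left : ‖x‖ = 1
  norm_right : ‖x'‖ = 1
  map_eq : f (rankOne ℂ x x) = rankOne ℂ x' x'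

/-- `f` acts on the multiples of rank-one projections by `σ`. -/
def ActsOnScalars (f : (H →L[ℂ] H) → (K →L[ℂ] K)) (σ : ℂ → ℂ) : Prop :=
  ∀ x x', MapsLine f x x' → ∀ c : ℂ, f (c • rankOne ℂ x x) = σ c • rankOne ℂ x' x'

theorem jmul_mem {𝒜 : NonUnitalStarSubalgebra ℂ (H →L[ℂ] H)} {A B : H →L[ℂ] H}
    (hA : A ∈ 𝒜) (hB : B ∈ 𝒜) : jmul A B ∈ 𝒜 :=
  SMulMemClass.smul_mem _ (add_mem (mul_mem hA hB) (mul_mem hB hA))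

variable {𝒜 : NonUnitalStarSubalgebra ℂ (H →L[ℂ] H)} {ℬ : NonUnitalStarSubalgebra ℂ (K →L[ℂ] K)}
  {f : (H →L[ℂ] H) → (K →L[ℂ] K)} {g : (K →L[ℂ] K) → (H →L[ℂ] H)}

namespace IsJordanStarIso

theorem smul_rankOne_mem (h : IsJordanStarIso 𝒜 ℬ f g) (c : ℂ) (x y : H) :
    c • rankOne ℂ x y ∈ 𝒜 :=
  SMulMemClass.smul_mem c (h.rankOne_mem x y)

theorem injOn (h : IsJordanStarIso 𝒜 ℬ f g) {A B : H →L[ℂ] H} (hA : A ∈ 𝒜) (hB : B ∈ 𝒜)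
    (hAB : f A = f B) : A = B := by
  rw [← h.left_inv A hA, hAB, h.left_inv B hB]

theorem symm (h : IsJordanStarIso 𝒜 ℬ f g) : IsJordanStarIso ℬ 𝒜 g f where
  rankOne_mem := h.rankOne_mem'
  rankOne_mem' := h.rankOne_mem
  map_mem := h.inv_mem
  inv_mem := h.map_mem
  left_inv := h.right_inv
  right_inv := h.left_inv
  map_star B hB := by
    refine h.injOn (h.inv_mem _ (star_mem hB)) (star_mem (h.inv_mem _ hB)) ?_
    rw [h.map_star _ (h.inv_mem _ hB), h.right_inv _ hB, h.right_inv _ (star_mem hB)]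
  map_jmul A hA B hB := by
    refine h.injOn (h.inv_mem _ (jmul_mem hA hB)) (jmul_mem (h.inv_mem _ hA) (h.inv_mem _ hB)) ?_
    rw [h.map_jmul _ (h.inv_mem _ hA) _ (h.inv_mem _ hB), h.right_inv _ hA, h.right_inv _ hB,
      h.right_inv _ (jmul_mem hA hB)]

/-- The adjoint reverses products, which the symmetric Jordan product does not see. This merges the
cases with `A*` into those with `A`. -/
theorem comp_star (h : IsJordanStarIso 𝒜 ℬ f g) :
    IsJordanStarIso 𝒜 ℬ (fun A => f (star A)) (fun B => star (g B)) where
  rankOne_mem := h.rankOne_mem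
  rankOne_mem' := h.rankOne_mem'
  map_mem A hA := h.map_mem _ (star_mem hA)
  inv_mem B hB := star_mem (h.inv_mem _ hB)
  left_inv A hA := by rw [h.left_inv _ (star_mem hA), star_star]
  right_inv B hB := by rw [star_star, h.right_inv _ hB]
  map_star A hA := h.map_star _ (star_mem hA)
  map_jmul A hA B hB := by
    rw [← h.map_jmul _ (star_mem hA) _ (star_mem hB)]
    congr 1
    simp only [jmul, star_smul, star_add, star_mul]
    rw [add_comm]
    congr 1
    simp

theorem map_zero (h : IsJordanStarIso 𝒜 ℬ f g) : f 0 = 0 := by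
  have := h.map_jmul 0 (zero_mem _) (g 0) (h.inv_mem _ (zero_mem _))
  rwa [h.right_inv _ (zero_mem _), zero_jmul, jmul_zero] at this

theorem eq_zero_of_map_eq_zero (h : IsJordanStarIso 𝒜 ℬ f g) {A : H →L[ℂ] H} (hA : A ∈ 𝒜)
    (h0 : f A = 0) : A = 0 :=
  h.injOn hA (zero_mem _) (h0.trans h.map_zero.symm)

theorem map_mul_self (h : IsJordanStarIso 𝒜 ℬ f g) {A : H →L[ℂ] H} (hA : A ∈ 𝒜) :
    f (A * A) = f A * f A := by
  rw [← jmul_self, h.map_jmul A hA A hA, jmul_self]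

/-- The image of `P = x ⊗ x*` is a nonzero projection, so it dominates some rank-one projection
`R'`. Then `g R'` is a nonzero idempotent below `P`, and minimality of `P` forces `g R' = P`. -/
theorem exists_mapsLine (h : IsJordanStarIso 𝒜 ℬ f g) {x : H} (hx : ‖x‖ = 1) :
    ∃ x', MapsLine f x x' := by
  have hP := h.rankOne_mem x x
  obtain ⟨x', hx', hle⟩ := exists_unit_rankOne_jmul_eq (P := f (rankOne ℂ x x))
    (fun h0 => rankOne_self_ne_zero hx (h.eq_zero_of_map_eq_zero hP h0))
    (by rw [← h.map_mul_self hP, rankOne_self_mul_self hx])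
    (by rw [← h.map_star _ hP, star_rankOne])
  refine ⟨x', hx, hx', ?_⟩
  have hP' := h.rankOne_mem' x' x'
  have hR := h.inv_mem _ hP'
  have hle' : jmul (rankOne ℂ x x) (g (rankOne ℂ x' x')) = g (rankOne ℂ x' x') := by
    refine h.injOn (jmul_mem hP hR) hR ?_
    rw [h.map_jmul _ hP _ hR, h.right_inv _ hP', hle]
  have hR0 : g (rankOne ℂ x' x') ≠ 0 := fun h0 =>
    rankOne_self_ne_zero hx' (h.symm.eq_zero_of_map_eq_zero hP' h0)
  have hRR : g (rankOne ℂ x' x') * g (rankOne ℂ x' x') = g (rankOne ℂ x' x') := by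
    rw [← h.symm.map_mul_self hP', rankOne_self_mul_self hx']
  have hform := eq_smul_rankOne_of_jmul_eq hx hle'
  set c := inner ℂ x (g (rankOne ℂ x' x') x)
  have hc : c * c = c := by
    rw [hform, smul_mul_smul_comm, rankOne_self_mul_self hx] at hRR
    exact smul_left_injective ℂ (rankOne_self_ne_zero hx) hRR
  have hc0 : c ≠ 0 := fun h0 => hR0 (by rw [hform, h0, zero_smul])
  rw [mul_eq_left₀ hc0] at hc
  rw [hc, one_smul] at hform
  rw [← hform, h.right_inv _ hP']

theorem mapsLine_symm (h : IsJordanStarIso 𝒜 ℬ f g) {x : H} {x' : K} (hx : MapsLine f x x') :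
    MapsLine g x' x :=
  ⟨hx.norm_right, hx.norm_left, by rw [← hx.map_eq, h.left_inv _ (h.rankOne_mem x x)]⟩

theorem exists_mapsLine_left (h : IsJordanStarIso 𝒜 ℬ f g) {x' : K} (hx : ‖x'‖ = 1) :
    ∃ x, MapsLine f x x' :=
  let ⟨x, hx⟩ := h.symm.exists_mapsLine hx
  ⟨x, h.symm.mapsLine_symm hx⟩

theorem inner_eq_zero (h : IsJordanStarIso 𝒜 ℬ f g) {x z : H} {x' z' : K}
    (hx : MapsLine f x x') (hz : MapsLine f z z') (h0 : inner ℂ x z = 0) : inner ℂ x' z' = 0 := by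
  have h0' : inner ℂ z x = 0 := inner_eq_zero_symm.1 h0
  have e := h.map_jmul _ (h.rankOne_mem x x) _ (h.rankOne_mem z z)
  have e0 : jmul (rankOne ℂ x x) (rankOne ℂ z z) = 0 := by
    rw [jmul, rankOne_mul_rankOne, rankOne_mul_rankOne, h0, h0']
    simp
  rw [e0, h.map_zero, hx.map_eq, hz.map_eq] at e
  have := (mul_eq_zero_of_jmul_eq_zero (rankOne_self_mul_self hx.norm_right) e.symm).1
  rw [rankOne_mul_rankOne, smul_eq_zero] at this
  refine this.resolve_right (rankOne_ne_zero ?_ ?_)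
  · rintro rfl; simpa using hx.norm_right
  · rintro rfl; simpa using hz.norm_right

theorem map_smul_rankOne (h : IsJordanStarIso 𝒜 ℬ f g) {x : H} {x' : K} (hx : MapsLine f x x')
    (c : ℂ) : f (c • rankOne ℂ x x) =
      inner ℂ x' (f (c • rankOne ℂ x x) x') • rankOne ℂ x' x' := by
  apply eq_smul_rankOne_of_jmul_eq hx.norm_right
  rw [← hx.map_eq, ← h.map_jmul _ (h.rankOne_mem x x) _ (h.smul_rankOne_mem c x x),
    jmul_rankOne_smul_eq hx.norm_left]

/-- A scalar can be moved across the Jordan product: `(cP) ∘ Q = P ∘ (cQ)`. Comparing images gives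
equal coefficients, because `P' ∘ Q'` vanishes only for orthogonal lines. -/
theorem coeff_eq_of_inner_ne_zero (h : IsJordanStarIso 𝒜 ℬ f g) {x z : H} {x' z' : K}
    (hx : MapsLine f x x') (hz : MapsLine f z z') (h0 : inner ℂ x z ≠ 0) {a b c : ℂ}
    (ha : f (c • rankOne ℂ x x) = a • rankOne ℂ x' x')
    (hb : f (c • rankOne ℂ z z) = b • rankOne ℂ z' z') : a = b := by
  have e₁ := h.map_jmul _ (h.smul_rankOne_mem c x x) _ (h.rankOne_mem z z)
  have e₂ := h.map_jmul _ (h.rankOne_mem x x) _ (h.smul_rankOne_mem c z z)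
  rw [smul_jmul, ha, hz.map_eq, smul_jmul] at e₁
  rw [jmul_smul, hb, hx.map_eq, jmul_smul, e₁] at e₂
  refine smul_left_injective ℂ (fun h1 => h0 ?_) e₂
  have := (mul_eq_zero_of_jmul_eq_zero (rankOne_self_mul_self hx.norm_right) h1).1
  rw [rankOne_mul_rankOne, smul_eq_zero] at this
  refine h.symm.inner_eq_zero (h.mapsLine_symm hx) (h.mapsLine_symm hz)
    (this.resolve_right (rankOne_ne_zero ?_ ?_))
  · rintro rfl; simpa using hx.norm_right
  · rintro rfl; simpa using hz.norm_right

theorem exists_actsOnScalars (h : IsJordanStarIso 𝒜 ℬ f g) : ∃ σ, ActsOnScalars f σ := by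
  by_cases hne : ∃ x₀ : H, ‖x₀‖ = 1
  swap
  · exact ⟨id, fun x x' hx => (hne ⟨x, hx.norm_left⟩).elim⟩
  obtain ⟨x₀, hx₀⟩ := hne
  obtain ⟨x₀', hx₀'⟩ := h.exists_mapsLine hx₀
  refine ⟨fun c => inner ℂ x₀' (f (c • rankOne ℂ x₀ x₀) x₀'), fun z z' hz c => ?_⟩
  have key : ∀ {x y : H} {x' y' : K}, MapsLine f x x' → MapsLine f y y' → inner ℂ x y ≠ 0 →
      inner ℂ x' (f (c • rankOne ℂ x x) x') = inner ℂ y' (f (c • rankOne ℂ y y) y') :=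
    fun hx hy h0 => h.coeff_eq_of_inner_ne_zero hx hy h0 (h.map_smul_rankOne hx c)
      (h.map_smul_rankOne hy c)
  suffices inner ℂ x₀' (f (c • rankOne ℂ x₀ x₀) x₀') = inner ℂ z' (f (c • rankOne ℂ z z) z') by
    rw [h.map_smul_rankOne hz c, ← this]
  by_cases h0 : inner ℂ x₀ z = 0
  swap
  · exact key hx₀' hz h0
  have hxz : x₀ + z ≠ 0 := fun e => by
    have := congrArg (inner ℂ x₀) e
    rw [inner_add_right, inner_self_eq_one hx₀, h0] at this
    simp at this
  -- For orthogonal `x₀` and `z`, the normalized sum is orthogonal to neither and links their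
  -- coefficients.
  set r : ℂ := ((‖x₀ + z‖⁻¹ : ℝ) : ℂ) with hr
  have hr0 : r ≠ 0 := by simpa [hr] using hxz
  have hw : ‖r • (x₀ + z)‖ = 1 := by
    rw [norm_smul, Complex.norm_real, norm_inv, norm_norm, inv_mul_cancel₀ (norm_ne_zero_iff.2 hxz)]
  obtain ⟨w', hw'⟩ := h.exists_mapsLine hw
  refine (key hx₀' hw' ?_).trans (key hw' hz ?_)
  · rw [inner_smul_right, inner_add_right, inner_self_eq_one hx₀, h0]
    simpa using hr0
  · rw [inner_smul_left, inner_add_left, inner_self_eq_one hz.norm_left, h0]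
    simpa using hr0

section Scalars

variable {σ : ℂ → ℂ}

theorem scalar_mul (h : IsJordanStarIso 𝒜 ℬ f g) (hσ : ActsOnScalars f σ) {x : H} {x' : K}
    (hx : MapsLine f x x') (c d : ℂ) : σ (c * d) = σ c * σ d := by
  have e := h.map_jmul _ (h.smul_rankOne_mem c x x) _ (h.smul_rankOne_mem d x x)
  rw [smul_jmul, jmul_rankOne_smul_eq hx.norm_left, smul_smul, hσ x x' hx, hσ x x' hx,
    hσ x x' hx, smul_jmul, jmul_rankOne_smul_eq hx.norm_right, smul_smul] at e
  exact smul_left_injective ℂ (rankOne_self_ne_zero hx.norm_right) e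

omit [CompleteSpace H] [CompleteSpace K] in
theorem scalar_one (hσ : ActsOnScalars f σ) {x : H} {x' : K} (hx : MapsLine f x x') :
    σ 1 = 1 := by
  have e := hσ x x' hx 1
  rw [one_smul, hx.map_eq] at e
  exact smul_left_injective ℂ (rankOne_self_ne_zero hx.norm_right) (by simpa using e.symm)

theorem scalar_zero (h : IsJordanStarIso 𝒜 ℬ f g) (hσ : ActsOnScalars f σ) {x : H} {x' : K}
    (hx : MapsLine f x x') : σ 0 = 0 := by
  have e := hσ x x' hx 0
  rw [zero_smul, h.map_zero] at e
  exact (smul_eq_zero.1 e.symm).resolve_right (rankOne_self_ne_zero hx.norm_right)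

theorem scalar_star (h : IsJordanStarIso 𝒜 ℬ f g) (hσ : ActsOnScalars f σ) {x : H} {x' : K}
    (hx : MapsLine f x x') (c : ℂ) : σ (star c) = star (σ c) := by
  have e := h.map_star _ (h.smul_rankOne_mem c x x)
  rw [star_smul, star_rankOne, hσ x x' hx, hσ x x' hx, star_smul, star_rankOne] at e
  exact smul_left_injective ℂ (rankOne_self_ne_zero hx.norm_right) e

end Scalars

end IsJordanStarIso

end JordanStarIso

/-! ### The operator exchanging two orthonormal vectors -/

section Orthonormal

variable {H : Type*} [NormedAddCommGroup H] [InnerProductSpace ℂ H] {x y : H}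

theorem rankOne_self_mul_eq_zero (hxy : inner ℂ x y = 0) :
    rankOne ℂ x x * rankOne ℂ y y = 0 := by
  rw [rankOne_mul_rankOne, hxy, zero_smul]

theorem jmul_rankOne_orthogonal (hxy : inner ℂ x y = 0) :
    jmul (rankOne ℂ x x) (rankOne ℂ y y) = 0 := by
  rw [jmul, rankOne_mul_rankOne, rankOne_mul_rankOne, hxy, inner_eq_zero_symm.1 hxy]
  simp

/-- The operator which exchanges the orthonormal vectors `x` and `y`. -/
noncomputable def flip₂ (x y : H) : H →L[ℂ] H := rankOne ℂ x y + rankOne ℂ y x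

theorem jmul_flip₂_left (hx : ‖x‖ = 1) (hxy : inner ℂ x y = 0) :
    jmul (flip₂ x y) (rankOne ℂ x x) = (1 / 2 : ℂ) • flip₂ x y := by
  simp only [jmul, flip₂, add_mul, mul_add, rankOne_mul_rankOne, hxy, inner_eq_zero_symm.1 hxy,
    inner_self_eq_one hx, zero_smul, one_smul, zero_add, add_zero]
  rw [add_comm]

theorem jmul_flip₂_right (hy : ‖y‖ = 1) (hxy : inner ℂ x y = 0) :
    jmul (flip₂ x y) (rankOne ℂ y y) = (1 / 2 : ℂ) • flip₂ x y := by
  simp only [jmul, flip₂, add_mul, mul_add, rankOne_mul_rankOne, hxy, inner_eq_zero_symm.1 hxy,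
    inner_self_eq_one hy, zero_smul, one_smul, zero_add, add_zero]

theorem flip₂_ne_zero (hx : ‖x‖ = 1) (hy : ‖y‖ = 1) (hxy : inner ℂ x y = 0) : flip₂ x y ≠ 0 := by
  intro h
  have := congrArg (fun T : H →L[ℂ] H => T y) h
  simp only [flip₂, add_apply, rankOne_apply, inner_self_eq_one hy, hxy,
    one_smul, zero_smul, add_zero, zero_apply] at this
  simp [this] at hx

theorem jmul_flip₂_diagonal (hx : ‖x‖ = 1) (hy : ‖y‖ = 1) (hxy : inner ℂ x y = 0) (a b : ℂ) :
    jmul (flip₂ x y) (a • rankOne ℂ x x + b • rankOne ℂ y y) = ((a + b) / 2) • flip₂ x y := by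
  rw [jmul_add, jmul_smul, jmul_smul, jmul_flip₂_left hx hxy, jmul_flip₂_right hy hxy, smul_smul,
    smul_smul, ← add_smul]
  congr 1
  ring

end Orthonormal

/-! ### Additivity of the scalar map and transport of quadratic forms -/

section JordanStarIso

variable {H K : Type*} [NormedAddCommGroup H] [InnerProductSpace ℂ H] [CompleteSpace H]
  [NormedAddCommGroup K] [InnerProductSpace ℂ K] [CompleteSpace K]
  {𝒜 : NonUnitalStarSubalgebra ℂ (H →L[ℂ] H)} {ℬ : NonUnitalStarSubalgebra ℂ (K →L[ℂ] K)}
  {f : (H →L[ℂ] H) → (K →L[ℂ] K)} {g : (K →L[ℂ] K) → (H →L[ℂ] H)}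
  {x y : H} {x' y' : K} {σ : ℂ → ℂ}

namespace IsJordanStarIso

/-- The image of the sum of two orthogonal rank-one projections dominates their images. -/
theorem jmul_map_add (h : IsJordanStarIso 𝒜 ℬ f g) (hx : MapsLine f x x')
    (hy : MapsLine f y y') (hxy : inner ℂ x y = 0) :
    jmul (f (rankOne ℂ x x + rankOne ℂ y y)) (rankOne ℂ x' x' + rankOne ℂ y' y') =
      rankOne ℂ x' x' + rankOne ℂ y' y' := by
  have hP := h.rankOne_mem x x
  have hQ := h.rankOne_mem y y
  have e₁ := h.map_jmul _ (add_mem hP hQ) _ hP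
  have e₂ := h.map_jmul _ (add_mem hP hQ) _ hQ
  rw [add_jmul, jmul_self, rankOne_self_mul_self hx.norm_left, jmul_comm (rankOne ℂ y y),
    jmul_rankOne_orthogonal hxy, add_zero, hx.map_eq] at e₁
  rw [add_jmul, jmul_self, rankOne_self_mul_self hy.norm_left,
    jmul_rankOne_orthogonal hxy, zero_add, hy.map_eq] at e₂
  rw [jmul_add, ← e₁, ← e₂]

theorem map_rankOne_add_rankOne (h : IsJordanStarIso 𝒜 ℬ f g) (hx : MapsLine f x x')
    (hy : MapsLine f y y') (hxy : inner ℂ x y = 0) :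
    f (rankOne ℂ x x + rankOne ℂ y y) = rankOne ℂ x' x' + rankOne ℂ y' y' := by
  have hxy' := h.inner_eq_zero hx hy hxy
  have hE' := add_mem (h.rankOne_mem' x' x') (h.rankOne_mem' y' y')
  have hE := add_mem (h.rankOne_mem x x) (h.rankOne_mem y y)
  have e := h.jmul_map_add hx hy hxy
  have e' := h.symm.jmul_map_add (h.mapsLine_symm hx) (h.mapsLine_symm hy) hxy'
  have e'' := h.map_jmul _ (h.inv_mem _ hE') _ hE
  -- Write `E` and `E'` for the two sums of projections. Both `g E' ∘ E = E` and `f E ∘ E' = E'`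
  -- hold, so applying `f` to the first gives `f E = E'`.
  rw [e', h.right_inv _ hE', jmul_comm, e] at e''
  exact e''

theorem map_diagonal (h : IsJordanStarIso 𝒜 ℬ f g) (hσ : ActsOnScalars f σ)
    (hx : MapsLine f x x') (hy : MapsLine f y y') (hxy : inner ℂ x y = 0) (a b : ℂ) :
    f (a • rankOne ℂ x x + b • rankOne ℂ y y) = σ a • rankOne ℂ x' x' + σ b • rankOne ℂ y' y' := by
  have hyx := inner_eq_zero_symm.1 hxy
  have hP := h.rankOne_mem x x
  have hQ := h.rankOne_mem y y
  have hD := add_mem (h.smul_rankOne_mem a x x) (h.smul_rankOne_mem b y y)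
  have f₁ : jmul (a • rankOne ℂ x x + b • rankOne ℂ y y) (rankOne ℂ x x) = a • rankOne ℂ x x := by
    rw [add_jmul, smul_jmul, smul_jmul, jmul_self, rankOne_self_mul_self hx.norm_left,
      jmul_rankOne_orthogonal hyx, smul_zero, add_zero]
  have f₂ : jmul (a • rankOne ℂ x x + b • rankOne ℂ y y) (rankOne ℂ y y) = b • rankOne ℂ y y := by
    rw [add_jmul, smul_jmul, smul_jmul, jmul_self, rankOne_self_mul_self hy.norm_left,
      jmul_rankOne_orthogonal hxy, smul_zero, zero_add]
  have e₁ := h.map_jmul _ hD _ hP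
  have e₂ := h.map_jmul _ hD _ hQ
  have e₃ := h.map_jmul _ hD _ (add_mem hP hQ)
  rw [f₁, hσ _ _ hx, hx.map_eq] at e₁
  rw [f₂, hσ _ _ hy, hy.map_eq] at e₂
  rw [jmul_add, f₁, f₂, h.map_rankOne_add_rankOne hx hy hxy, jmul_add, ← e₁, ← e₂] at e₃
  exact e₃

theorem flip₂_mem (h : IsJordanStarIso 𝒜 ℬ f g) (x y : H) : flip₂ x y ∈ 𝒜 :=
  add_mem (h.rankOne_mem x y) (h.rankOne_mem y x)

theorem map_flip₂_ne_zero (h : IsJordanStarIso 𝒜 ℬ f g) (hx : ‖x‖ = 1) (hy : ‖y‖ = 1)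
    (hxy : inner ℂ x y = 0) : f (flip₂ x y) ≠ 0 := fun h0 =>
  flip₂_ne_zero hx hy hxy (h.eq_zero_of_map_eq_zero (h.flip₂_mem x y) h0)

theorem map_smul_flip₂ (h : IsJordanStarIso 𝒜 ℬ f g) (hσ : ActsOnScalars f σ)
    (hx : MapsLine f x x') (hy : MapsLine f y y') (hxy : inner ℂ x y = 0) (c : ℂ) :
    f (c • flip₂ x y) = σ c • f (flip₂ x y) := by
  have hS := h.flip₂_mem x y
  have e := h.map_jmul _ hS _ (add_mem (h.smul_rankOne_mem c x x) (h.smul_rankOne_mem c y y))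
  have e₁ := h.map_jmul _ hS _ (add_mem (h.smul_rankOne_mem 1 x x) (h.smul_rankOne_mem 1 y y))
  rw [jmul_flip₂_diagonal hx.norm_left hy.norm_left hxy, h.map_diagonal hσ hx hy hxy, ← smul_add,
    jmul_smul] at e
  rw [jmul_flip₂_diagonal hx.norm_left hy.norm_left hxy, h.map_diagonal hσ hx hy hxy,
    scalar_one hσ hx, one_smul, one_smul] at e₁
  norm_num at e₁
  rw [← e₁] at e
  rw [← e]
  congr 2
  ring

/-- Before additivity is known, these products only give the factor `σ (1 / 2)`. Since `S ∘ (P + Q)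
= S`, adding the two yields `2 σ (1 / 2) = 1`. -/
theorem jmul_map_flip₂ (h : IsJordanStarIso 𝒜 ℬ f g) (hσ : ActsOnScalars f σ)
    (hx : MapsLine f x x') (hy : MapsLine f y y') (hxy : inner ℂ x y = 0) :
    jmul (f (flip₂ x y)) (rankOne ℂ x' x') = (1 / 2 : ℂ) • f (flip₂ x y) ∧
      jmul (f (flip₂ x y)) (rankOne ℂ y' y') = (1 / 2 : ℂ) • f (flip₂ x y) := by
  have hP := h.rankOne_mem x x
  have hQ := h.rankOne_mem y y
  have hS := h.flip₂_mem x y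
  have e₁ := h.map_jmul _ hS _ hP
  have e₂ := h.map_jmul _ hS _ hQ
  have e₃ := h.map_jmul _ hS _ (add_mem hP hQ)
  rw [jmul_flip₂_left hx.norm_left hxy, h.map_smul_flip₂ hσ hx hy hxy, hx.map_eq] at e₁
  rw [jmul_flip₂_right hy.norm_left hxy, h.map_smul_flip₂ hσ hx hy hxy, hy.map_eq] at e₂
  rw [h.map_rankOne_add_rankOne hx hy hxy, jmul_add, jmul_add, jmul_flip₂_left hx.norm_left hxy,
    jmul_flip₂_right hy.norm_left hxy, ← e₁, ← e₂, ← add_smul, ← add_smul, add_halves,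
    one_smul] at e₃
  have hhalf : σ (1 / 2) = 1 / 2 := by
    have : (σ (1 / 2) + σ (1 / 2)) • f (flip₂ x y) = (1 : ℂ) • f (flip₂ x y) := by
      rw [← e₃, one_smul]
    have := smul_left_injective ℂ (h.map_flip₂_ne_zero hx.norm_left hy.norm_left hxy) this
    linear_combination (1 / 2) * this
  rw [← e₁, ← e₂, hhalf]
  exact ⟨rfl, rfl⟩

theorem scalar_add (h : IsJordanStarIso 𝒜 ℬ f g) (hσ : ActsOnScalars f σ)
    (hx : MapsLine f x x') (hy : MapsLine f y y') (hxy : inner ℂ x y = 0) (a b : ℂ) :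
    σ (a + b) = σ a + σ b := by
  have hS := h.flip₂_mem x y
  obtain ⟨e₁, e₂⟩ := h.jmul_map_flip₂ hσ hx hy hxy
  have key : ∀ a b : ℂ, σ ((a + b) / 2) = (σ a + σ b) / 2 := by
    intro a b
    have e := h.map_jmul _ hS _ (add_mem (h.smul_rankOne_mem a x x) (h.smul_rankOne_mem b y y))
    rw [jmul_flip₂_diagonal hx.norm_left hy.norm_left hxy, h.map_diagonal hσ hx hy hxy,
      h.map_smul_flip₂ hσ hx hy hxy, jmul_add, jmul_smul, jmul_smul, e₁, e₂,
      smul_smul, smul_smul, ← add_smul] at e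
    rw [smul_left_injective ℂ (h.map_flip₂_ne_zero hx.norm_left hy.norm_left hxy) e]
    ring
  -- Taking one entry zero in the midpoint identity compares `σ (a + b)` with `σ a + σ b`.
  have k₁ := key (a + b) 0
  rw [add_zero, key, h.scalar_zero hσ hx] at k₁
  linear_combination -2 * k₁

/-- The diagonal matrix entries of `f A` are determined by those of `A`. -/
theorem inner_map_apply (h : IsJordanStarIso 𝒜 ℬ f g) (hσ : ActsOnScalars f σ)
    (hH : 1 < Module.rank ℂ H) (hx : MapsLine f x x') {A : H →L[ℂ] H} (hA : A ∈ 𝒜) :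
    inner ℂ x' (f A x') = σ (inner ℂ x (A x)) := by
  obtain ⟨y, hy, hxy⟩ := exists_unit_orthogonal hH x
  obtain ⟨y', hy⟩ := h.exists_mapsLine hy
  have hxy' := h.inner_eq_zero hx hy hxy
  have hP := h.rankOne_mem x x
  have hQ := h.rankOne_mem y y
  have hS := h.flip₂_mem x y
  obtain ⟨e₁, e₂⟩ := h.jmul_map_flip₂ hσ hx hy hxy
  have e := jmul_offDiagonal (rankOne_self_mul_self hx.norm_left) (rankOne_self_mul_eq_zero hxy)
    (rankOne_self_mul_eq_zero (inner_eq_zero_symm.1 hxy))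
    (mul_add_mul_eq_of_jmul_eq_half (jmul_flip₂_left hx.norm_left hxy))
    (mul_add_mul_eq_of_jmul_eq_half (jmul_flip₂_right hy.norm_left hxy))
    (rankOne_self_mul_mul A x)
  have e' := jmul_offDiagonal (rankOne_self_mul_self hx.norm_right) (rankOne_self_mul_eq_zero hxy')
    (rankOne_self_mul_eq_zero (inner_eq_zero_symm.1 hxy')) (mul_add_mul_eq_of_jmul_eq_half e₁)
    (mul_add_mul_eq_of_jmul_eq_half e₂) (rankOne_self_mul_mul (f A) x')
  have e'' := congrArg f e
  have m₁ := jmul_mem hA hP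
  have m₂ := jmul_mem hS m₁
  have m₃ := jmul_mem hP m₂
  rw [h.map_jmul _ hQ _ m₃, h.map_jmul _ hP _ m₂, h.map_jmul _ hS _ m₁, h.map_jmul _ hA _ hP,
    hx.map_eq, hy.map_eq, e', h.map_smul_flip₂ hσ hx hy hxy] at e''
  -- The same nested product, computed before and after `f`, compares the two diagonal entries up to
  -- the factor `1 / 8`, which additivity of `σ` removes.
  have e₈ := smul_left_injective ℂ (h.map_flip₂_ne_zero hx.norm_left hy.norm_left hxy) e''
  have hadd := h.scalar_add hσ hx hy hxy
  set a := inner ℂ x (A x)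
  have : σ a = 8 * σ (a / 8) := by
    have : a = a / 8 + a / 8 + a / 8 + a / 8 + a / 8 + a / 8 + a / 8 + a / 8 := by ring
    nth_rw 1 [this]
    simp only [hadd]
    ring
  rw [this, ← e₈]
  ring

end IsJordanStarIso

end JordanStarIso

/-- A ring endomorphism of `ℂ` which commutes with conjugation is trivial or the conjugation. -/
theorem ringHom_eq_id_or_conj (τ : ℂ →+* ℂ) (hτ : ∀ z, τ (star z) = star (τ z)) :
    (∀ z, τ z = z) ∨ ∀ z, τ z = star z := by
  have him : ∀ r : ℝ, (((τ r).re : ℝ) : ℂ) = τ r := fun r =>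
    Complex.conj_eq_iff_re.1 (by
      have := hτ r
      rw [Complex.star_def, Complex.conj_ofReal] at this
      exact this.symm)
  -- Commuting with conjugation keeps real numbers real, and the only ring endomorphism of `ℝ` is
  -- the identity; hence `τ` is `ℝ`-linear.
  let ρ : ℝ →+* ℝ :=
    { toFun := fun r => (τ r).re
      map_one' := by simp
      map_zero' := by simp
      map_add' := fun r s => by simp
      map_mul' := fun r s => by
        rw [Complex.ofReal_mul, map_mul, ← him r, ← him s]
        simp }
  have hρ : ∀ r : ℝ, (τ r).re = r := fun r =>
    congrArg (fun θ : ℝ →+* ℝ => θ r) (Subsingleton.elim ρ (RingHom.id ℝ))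
  have hcomm : ∀ r : ℝ, τ (algebraMap ℝ ℂ r) = algebraMap ℝ ℂ r := fun r => by
    change τ (r : ℂ) = r
    rw [← him, hρ]
  let θ : ℂ →ₐ[ℝ] ℂ := { τ with commutes' := hcomm }
  rcases Complex.real_algHom_eq_id_or_conj θ with e | e
  · exact Or.inl fun z => congrArg (fun θ : ℂ →ₐ[ℝ] ℂ => θ z) e
  · exact Or.inr fun z => congrArg (fun θ : ℂ →ₐ[ℝ] ℂ => θ z) e

theorem ext_inner_unit {K : Type*} [NormedAddCommGroup K] [InnerProductSpace ℂ K]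
    {S T : K →L[ℂ] K} (h : ∀ x : K, ‖x‖ = 1 → inner ℂ x (S x) = inner ℂ x (T x)) : S = T := by
  have hall : ∀ x : K, inner ℂ x (S x) = inner ℂ x (T x) := by
    intro x
    by_cases hx : x = 0
    · simp [hx]
    have := h (((‖x‖⁻¹ : ℝ) : ℂ) • x) (by
      rw [norm_smul, Complex.norm_real, norm_inv, norm_norm,
        inv_mul_cancel₀ (norm_ne_zero_iff.2 hx)])
    simpa [inner_smul_left, inner_smul_right, hx] using this
  have : (S : K →ₗ[ℂ] K) = T := (ext_inner_map _ _).1 fun x => by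
    rw [← inner_conj_symm, ← inner_conj_symm _ x]
    exact congrArg _ (hall x)
  exact ContinuousLinearMap.coe_injective this

section Conjugation

variable {H K : Type*} [NormedAddCommGroup H] [InnerProductSpace ℂ H]
  [NormedAddCommGroup K] [InnerProductSpace ℂ K]

theorem unitaryConj_apply [CompleteSpace H] [CompleteSpace K] (U : UnitaryOperator H K)
    (T : H →L[ℂ] H) (z : H) : unitaryConj U T (U z) = U (T z) := by
  have : ContinuousLinearMap.adjoint (U.toContinuousLinearEquiv : H →L[ℂ] K) (U z) = z := by
    refine ext_inner_right ℂ fun v => ?_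
    rw [ContinuousLinearMap.adjoint_inner_left]
    exact U.inner_map_map z v
  simp only [unitaryConj, ContinuousLinearMap.comp_apply, this]
  rfl

theorem antiunitaryConj_apply (U : AntiunitaryOperator H K) (T : H →L[ℂ] H) (z : H) :
    antiunitaryConj U T (U z) = U (T z) :=
  congrArg (fun v => U (T v)) (U.symm_apply_apply z)

end Conjugation

/-! ### Additivity of the map and images of rank-one nilpotents -/

section JordanStarIso

variable {H K : Type*} [NormedAddCommGroup H] [InnerProductSpace ℂ H] [CompleteSpace H]
  [NormedAddCommGroup K] [InnerProductSpace ℂ K] [CompleteSpace K]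
  {𝒜 : NonUnitalStarSubalgebra ℂ (H →L[ℂ] H)} {ℬ : NonUnitalStarSubalgebra ℂ (K →L[ℂ] K)}
  {f : (H →L[ℂ] H) → (K →L[ℂ] K)} {g : (K →L[ℂ] K) → (H →L[ℂ] H)}
  {x : H} {x' : K} {σ : ℂ → ℂ}

namespace IsJordanStarIso

theorem exists_mapsLine_pair (h : IsJordanStarIso 𝒜 ℬ f g) (hH : 1 < Module.rank ℂ H)
    (x : H) : ∃ y y', MapsLine f y y' ∧ inner ℂ x y = 0 := by
  obtain ⟨y, hy, hxy⟩ := exists_unit_orthogonal hH x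
  obtain ⟨y', hy⟩ := h.exists_mapsLine hy
  exact ⟨y, y', hy, hxy⟩

theorem scalar_eq_id_or_conj (h : IsJordanStarIso 𝒜 ℬ f g) (hσ : ActsOnScalars f σ)
    (hH : 1 < Module.rank ℂ H) : σ = id ∨ σ = star := by
  -- Orthogonality to `0` is no condition; this only produces some unit vector.
  obtain ⟨x, x', hx, -⟩ := h.exists_mapsLine_pair hH 0
  obtain ⟨y, y', hy, hxy⟩ := h.exists_mapsLine_pair hH x
  let τ : ℂ →+* ℂ :=
    { toFun := σ
      map_one' := scalar_one hσ hx
      map_zero' := h.scalar_zero hσ hx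
      map_add' := h.scalar_add hσ hx hy hxy
      map_mul' := h.scalar_mul hσ hx }
  rcases ringHom_eq_id_or_conj τ (h.scalar_star hσ hx) with e | e
  · exact Or.inl (funext e)
  · exact Or.inr (funext e)

/-- Every unit vector of `K` spans the image of a line of `H`, so these vectors suffice for
polarization. -/
theorem eq_of_inner_eq (h : IsJordanStarIso 𝒜 ℬ f g) {S T : K →L[ℂ] K}
    (hST : ∀ x x', MapsLine f x x' → inner ℂ x' (S x') = inner ℂ x' (T x')) : S = T :=
  ext_inner_unit fun _ hx' =>
    let ⟨x, hx⟩ := h.exists_mapsLine_left hx'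
    hST x _ hx

theorem map_add (h : IsJordanStarIso 𝒜 ℬ f g) (hH : 1 < Module.rank ℂ H) {A B : H →L[ℂ] H}
    (hA : A ∈ 𝒜) (hB : B ∈ 𝒜) : f (A + B) = f A + f B := by
  obtain ⟨σ, hσ⟩ := h.exists_actsOnScalars
  refine h.eq_of_inner_eq fun x x' hx => ?_
  obtain ⟨y, y', hy, hxy⟩ := h.exists_mapsLine_pair hH x
  rw [h.inner_map_apply hσ hH hx (add_mem hA hB), add_apply, add_apply, inner_add_right,
    inner_add_right, h.scalar_add hσ hx hy hxy, h.inner_map_apply hσ hH hx hA,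
    h.inner_map_apply hσ hH hx hB]

theorem map_smul (h : IsJordanStarIso 𝒜 ℬ f g) (hσ : ActsOnScalars f σ)
    (hH : 1 < Module.rank ℂ H) (c : ℂ) {A : H →L[ℂ] H}
    (hA : A ∈ 𝒜) : f (c • A) = σ c • f A := by
  refine h.eq_of_inner_eq fun x x' hx => ?_
  rw [h.inner_map_apply hσ hH hx (SMulMemClass.smul_mem c hA), smul_apply, smul_apply,
    inner_smul_right, inner_smul_right, h.scalar_mul hσ hx, h.inner_map_apply hσ hH hx hA]

theorem map_half_smul (h : IsJordanStarIso 𝒜 ℬ f g) (hH : 1 < Module.rank ℂ H)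
    {A : H →L[ℂ] H} (hA : A ∈ 𝒜) : f ((1 / 2 : ℂ) • A) = (1 / 2 : ℂ) • f A := by
  obtain ⟨σ, hσ⟩ := h.exists_actsOnScalars
  rw [h.map_smul hσ hH _ hA]
  rcases h.scalar_eq_id_or_conj hσ hH with rfl | rfl <;> simp

theorem mul_add_mul_map_rankOne (h : IsJordanStarIso 𝒜 ℬ f g) (hH : 1 < Module.rank ℂ H)
    (hx : MapsLine f x x') {y : H} (hxy : inner ℂ x y = 0) :
    f (rankOne ℂ y x) * rankOne ℂ x' x' + rankOne ℂ x' x' * f (rankOne ℂ y x) =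
      f (rankOne ℂ y x) := by
  apply mul_add_mul_eq_of_jmul_eq_half
  rw [← hx.map_eq, ← h.map_jmul _ (h.rankOne_mem y x) _ (h.rankOne_mem x x),
    ← h.map_half_smul hH (h.rankOne_mem y x), jmul, rankOne_mul_rankOne, rankOne_mul_rankOne,
    hxy, inner_self_eq_one hx.norm_left]
  simp

theorem map_rankOne_apply (h : IsJordanStarIso 𝒜 ℬ f g) (hH : 1 < Module.rank ℂ H)
    (hx : MapsLine f x x') {y : H} (hxy : inner ℂ x y = 0) (z : K) :
    f (rankOne ℂ y x) z = inner ℂ x' z • f (rankOne ℂ y x) x' +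
      inner ℂ (star (f (rankOne ℂ y x)) x') z • x' := by
  have e := congrArg (fun T : K →L[ℂ] K => T z) (h.mul_add_mul_map_rankOne hH hx hxy)
  simp only [add_apply, mul_apply_eq_comp, rankOne_apply, _root_.map_smul] at e
  rw [ContinuousLinearMap.star_eq_adjoint, ContinuousLinearMap.adjoint_inner_left]
  exact e.symm

/-- The image of `y ⊗ x*` is of the form `u ⊗ x'*` or `x' ⊗ v*`. -/
theorem map_rankOne_apply_eq_zero_or (h : IsJordanStarIso 𝒜 ℬ f g) (hH : 1 < Module.rank ℂ H)
    (hx : MapsLine f x x') {y : H} (hxy : inner ℂ x y = 0) :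
    f (rankOne ℂ y x) x' = 0 ∨ star (f (rankOne ℂ y x)) x' = 0 := by
  have hT := h.map_rankOne_apply hH hx hxy
  have hsq : f (rankOne ℂ y x) * f (rankOne ℂ y x) = 0 := by
    rw [← h.map_mul_self (h.rankOne_mem y x), rankOne_mul_rankOne, hxy, zero_smul, h.map_zero]
  set T := f (rankOne ℂ y x)
  have hTT : ∀ z, T (T z) = 0 := fun z => congrArg (fun T : K →L[ℂ] K => T z) hsq
  -- With `u = T x'` and `v = T* x'`, `T z = ⟨x', z⟩ u + ⟨v, z⟩ x'`. Evaluating `T² = 0` at `v`,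
  -- where `T u = 0`, leaves `‖v‖² u = 0`.
  have e := hTT (star T x')
  rw [hT (star T x'), _root_.map_add, _root_.map_smul, _root_.map_smul, hTT, smul_zero, zero_add,
    smul_eq_zero, inner_self_eq_zero] at e
  exact e.symm

/-- By additivity each alternative defines an additive subgroup of the `y ⊥ x`, and a group is not
the union of two proper subgroups. -/
theorem map_rankOne_type (h : IsJordanStarIso 𝒜 ℬ f g) (hH : 1 < Module.rank ℂ H)
    (hx : MapsLine f x x') :
    (∀ y, inner ℂ x y = 0 → f (rankOne ℂ y x) x' = 0) ∨
      ∀ y, inner ℂ x y = 0 → star (f (rankOne ℂ y x)) x' = 0 := by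
  by_contra! hcon
  obtain ⟨⟨y, hy, hu⟩, z, hz, hv⟩ := hcon
  have hv₀ := (h.map_rankOne_apply_eq_zero_or hH hx hy).resolve_left hu
  have hu₀ := (h.map_rankOne_apply_eq_zero_or hH hx hz).resolve_right hv
  have e := h.map_rankOne_apply_eq_zero_or hH hx (y := y + z) (by rw [inner_add_right, hy, hz,
    add_zero])
  rw [_root_.map_add, add_apply, h.map_add hH (h.rankOne_mem y x) (h.rankOne_mem z x), add_apply,
    star_add, add_apply, hu₀, hv₀, add_zero, zero_add] at e
  exact e.elim hu hv

theorem map_smul_rankOne_apply (h : IsJordanStarIso 𝒜 ℬ f g) (hH : 1 < Module.rank ℂ H)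
    (hσ : ActsOnScalars f σ) (c : ℂ) (y : H) :
    f (rankOne ℂ (c • y) x) x' = σ c • f (rankOne ℂ y x) x' := by
  rw [_root_.map_smul, smul_apply, h.map_smul hσ hH _ (h.rankOne_mem y x), smul_apply]

theorem map_add_rankOne_apply (h : IsJordanStarIso 𝒜 ℬ f g) (hH : 1 < Module.rank ℂ H)
    (y z : H) :
    f (rankOne ℂ (y + z) x) x' = f (rankOne ℂ y x) x' + f (rankOne ℂ z x) x' := by
  rw [_root_.map_add, add_apply, h.map_add hH (h.rankOne_mem y x) (h.rankOne_mem z x), add_apply]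

/-! ### Construction of the implementing isometry -/

section Implementation

variable (h : IsJordanStarIso 𝒜 ℬ f g) (hH : 1 < Module.rank ℂ H) (hσ : ActsOnScalars f σ)
  (hx : MapsLine f x x') (hv : ∀ y, inner ℂ x y = 0 → star (f (rankOne ℂ y x)) x' = 0)

include h hH hx hv

theorem map_rankOne_eq (y : H) :
    f (rankOne ℂ y x) = rankOne ℂ (f (rankOne ℂ y x) x') x' := by
  obtain ⟨σ, hσ⟩ := h.exists_actsOnScalars
  set w := y - inner ℂ x y • x with hw
  have hxw : inner ℂ x w = 0 := by
    rw [hw, inner_sub_right, inner_smul_right, inner_self_eq_one hx.norm_left, mul_one, sub_self]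
  have hy : rankOne ℂ y x = inner ℂ x y • rankOne ℂ x x + rankOne ℂ w x := by
    rw [hw]
    simp
  have hfw : f (rankOne ℂ w x) = rankOne ℂ (f (rankOne ℂ w x) x') x' := by
    ext z
    rw [h.map_rankOne_apply hH hx hxw, hv w hxw, inner_zero_left, zero_smul, add_zero,
      rankOne_apply]
  rw [hy, h.map_add hH (h.smul_rankOne_mem _ x x) (h.rankOne_mem w x), hσ x x' hx, hfw]
  ext z
  simp [hx.norm_right]

/-- This is the image of the Jordan product of `y ⊗ x*` with its adjoint. It links `U y`, where `U y
= f(y ⊗ x*) x'`, to the image of `y ⊗ y*`. -/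
theorem jmul_map_rankOne (y : H) :
    rankOne ℂ (f (rankOne ℂ y x) x') (f (rankOne ℂ y x) x') +
        inner ℂ (f (rankOne ℂ y x) x') (f (rankOne ℂ y x) x') • rankOne ℂ x' x' =
      f (rankOne ℂ y y) + inner ℂ y y • rankOne ℂ x' x' := by
  obtain ⟨σ, hσ⟩ := h.exists_actsOnScalars
  have e := h.map_jmul _ (h.rankOne_mem y x) _ (h.rankOne_mem x y)
  have m₁ := h.rankOne_mem y y
  have m₂ := h.smul_rankOne_mem (inner ℂ y y) x x
  have e₁ := h.map_rankOne_eq hH hx hv y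
  generalize f (rankOne ℂ y x) x' = u at e₁ ⊢
  have e₂ : f (rankOne ℂ x y) = rankOne ℂ x' u := by
    rw [← star_rankOne y x, h.map_star _ (h.rankOne_mem y x), e₁, star_rankOne]
  rw [e₂, e₁, jmul, jmul] at e
  simp only [rankOne_mul_rankOne, inner_self_eq_one hx.norm_left, inner_self_eq_one hx.norm_right,
    one_smul] at e
  rw [h.map_half_smul hH (add_mem m₁ m₂), h.map_add hH m₁ m₂, hσ x x' hx] at e
  have hreal : σ (inner ℂ y y) = inner ℂ y y := by
    rcases h.scalar_eq_id_or_conj hσ hH with rfl | rfl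
    · rfl
    · exact inner_conj_symm y y
  rw [hreal] at e
  exact (smul_right_injective _ (by norm_num : (1 / 2 : ℂ) ≠ 0) e).symm

theorem inner_self_map_rankOne (y : H) :
    inner ℂ (f (rankOne ℂ y x) x') (f (rankOne ℂ y x) x') = inner ℂ y y := by
  obtain ⟨σ, hσ⟩ := h.exists_actsOnScalars
  have e := congrArg (fun T : K →L[ℂ] K => inner ℂ x' (T x')) (h.jmul_map_rankOne hH hx hv y)
  have e₁ := h.inner_map_apply hσ hH hx (h.rankOne_mem y x)
  have e₂ := h.inner_map_apply hσ hH hx (h.rankOne_mem y y)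
  simp only [add_apply, smul_apply, inner_add_right, e₂] at e
  simp only [rankOne_apply, inner_smul_right, inner_self_eq_one hx.norm_left,
    inner_self_eq_one hx.norm_right, one_mul, mul_one] at e e₁
  -- In the diagonal entry at `x'`, the terms from `|⟨x', U y⟩|²` and `σ(|⟨x, y⟩|²)` agree because
  -- `⟨x', U y⟩ = σ ⟨x, y⟩`; they cancel and leave the norms.
  rw [← inner_conj_symm, e₁, h.scalar_mul hσ hx, ← inner_conj_symm y x] at e
  have : σ ((starRingEnd ℂ) (inner ℂ x y)) = (starRingEnd ℂ) (σ (inner ℂ x y)) :=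
    h.scalar_star hσ hx _
  rw [this] at e
  exact add_left_cancel e

theorem norm_map_rankOne (y : H) : ‖f (rankOne ℂ y x) x'‖ = ‖y‖ := by
  rw [@norm_eq_sqrt_re_inner ℂ, @norm_eq_sqrt_re_inner ℂ _ _ _ _ y,
    h.inner_self_map_rankOne hH hx hv]

theorem mapsLine_map_rankOne {y : H} (hy : ‖y‖ = 1) : MapsLine f y (f (rankOne ℂ y x) x') where
  norm_left := hy
  norm_right := by rw [h.norm_map_rankOne hH hx hv, hy]
  map_eq := by
    have := h.jmul_map_rankOne hH hx hv y
    rw [h.inner_self_map_rankOne hH hx hv] at this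
    exact (add_right_cancel this).symm

include hσ

theorem surjective_map_rankOne : Function.Surjective fun y => f (rankOne ℂ y x) x' := by
  intro w
  by_cases hw : w = 0
  · refine ⟨0, ?_⟩
    simp [h.map_zero, hw]
  have hr : ((‖w‖ : ℝ) : ℂ) ≠ 0 := by simpa using hw
  obtain ⟨z, hz⟩ := h.exists_mapsLine_left (x' := ((‖w‖⁻¹ : ℝ) : ℂ) • w) (by
    rw [norm_smul, Complex.norm_real, norm_inv, norm_norm, inv_mul_cancel₀ (norm_ne_zero_iff.2 hw)])
  have hz' := h.mapsLine_map_rankOne hH hx hv hz.norm_left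
  have e : ∃ d : ℂ, w = d • f (rankOne ℂ z x) x' := by
    have e := hz'.map_eq.symm.trans hz.map_eq
    have := congrArg (fun T : K →L[ℂ] K => T (((‖w‖⁻¹ : ℝ) : ℂ) • w)) e
    simp only [rankOne_apply, inner_self_eq_one hz.norm_right, one_smul] at this
    have hw' : w = ((‖w‖ : ℝ) : ℂ) • ((‖w‖⁻¹ : ℝ) : ℂ) • w := by
      rw [smul_smul, Complex.ofReal_inv, mul_inv_cancel₀ hr, one_smul]
    exact ⟨_, hw'.trans (by rw [← this, smul_smul])⟩
  obtain ⟨d, hd⟩ := e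
  -- `U` is `σ`-semilinear and `σ` is an involution, so `σ d • z` is sent to `d • U z`.
  refine ⟨σ d • z, ?_⟩
  change f (rankOne ℂ (σ d • z) x) x' = w
  rw [h.map_smul_rankOne_apply hH hσ, hd]
  rcases h.scalar_eq_id_or_conj hσ hH with rfl | rfl <;> simp

theorem inner_map_apply_map_rankOne {A : H →L[ℂ] H} (hA : A ∈ 𝒜) {z : H} (hz : ‖z‖ = 1) :
    inner ℂ (f (rankOne ℂ z x) x') (f A (f (rankOne ℂ z x) x')) = σ (inner ℂ z (A z)) :=
  h.inner_map_apply hσ hH (h.mapsLine_map_rankOne hH hx hv hz) hA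

theorem exists_unitary_or_antiunitary :
    (∃ U : UnitaryOperator H K, ∀ A ∈ 𝒜, f A = unitaryConj U A) ∨
      ∃ U : AntiunitaryOperator H K, ∀ A ∈ 𝒜, f A = antiunitaryConj U A := by
  have hadd := h.map_add_rankOne_apply hH (x := x) (x' := x')
  have hsmul := h.map_smul_rankOne_apply hH hσ (x := x) (x' := x')
  have hnorm := h.norm_map_rankOne hH hx hv
  have hsurj := h.surjective_map_rankOne hH hσ hx hv
  have hinner := fun A hA z hz => h.inner_map_apply_map_rankOne hH hσ hx hv (A := A) hA (z := z) hz
  rcases h.scalar_eq_id_or_conj hσ hH with rfl | rfl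
  · left
    let V : H →ₗᵢ[ℂ] K :=
      { toFun := fun y => f (rankOne ℂ y x) x'
        map_add' := hadd
        map_smul' := hsmul
        norm_map' := hnorm }
    let U : H ≃ₗᵢ[ℂ] K := LinearIsometryEquiv.ofSurjective V hsurj
    refine ⟨U, fun A hA => ext_inner_unit fun w hw => ?_⟩
    obtain ⟨z, rfl⟩ := U.surjective w
    rw [unitaryConj_apply, U.inner_map_map]
    exact hinner A hA z (by rwa [U.norm_map] at hw)
  · right
    let V : H →ₛₗᵢ[starRingEnd ℂ] K :=
      { toFun := fun y => f (rankOne ℂ y x) x'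
        map_add' := hadd
        map_smul' := hsmul
        norm_map' := hnorm }
    let U : H ≃ₛₗᵢ[starRingEnd ℂ] K := LinearIsometryEquiv.ofSurjective V hsurj
    refine ⟨U, fun A hA => ext_inner_unit fun w hw => ?_⟩
    obtain ⟨z, rfl⟩ := U.surjective w
    -- The swap of arguments under `U` is the conjugation by which `σ` acts on the quadratic form.
    rw [antiunitaryConj_apply, AntiunitaryOperator.inner_map_map, ← inner_conj_symm (A z)]
    exact hinner A hA z (by rwa [U.norm_map] at hw)

end Implementation

end IsJordanStarIso

end JordanStarIso

/-! ### The main theorem -/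

theorem IsStandardOperatorAlgebra.rankOne_mem {X : Type*} [NormedAddCommGroup X]
    [InnerProductSpace ℂ X] {𝒜 : NonUnitalSubalgebra ℂ (X →L[ℂ] X)}
    (h : IsStandardOperatorAlgebra 𝒜) (x y : X) : rankOne ℂ x y ∈ 𝒜 := by
  refine h _ ?_
  refine Submodule.finiteDimensional_of_le (S₂ := ℂ ∙ x) ?_
  rintro _ ⟨z, rfl⟩
  exact Submodule.smul_mem _ _ (Submodule.mem_span_singleton_self x)

theorem corollary1 {H K : Type*}
    [NormedAddCommGroup H] [InnerProductSpace ℂ H] [CompleteSpace H]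
    [NormedAddCommGroup K] [InnerProductSpace ℂ K] [CompleteSpace K]
    (hH : 1 < Module.rank ℂ H)
    (𝒜 : NonUnitalStarSubalgebra ℂ (H →L[ℂ] H)) (ℬ : NonUnitalStarSubalgebra ℂ (K →L[ℂ] K))
    (h𝒜 : IsStandardOperatorAlgebra 𝒜.toNonUnitalSubalgebra)
    (hℬ : IsStandardOperatorAlgebra ℬ.toNonUnitalSubalgebra)
    (φ : 𝒜 → ℬ) (hφ : Function.Bijective φ)
    (hstar : ∀ A : 𝒜, φ (star A) = star (φ A))
    (hjordan : ∀ A B : 𝒜,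
      φ ((1 / 2 : ℂ) • (A * B + B * A)) = (1 / 2 : ℂ) • (φ A * φ B + φ B * φ A)) :
    (∃ U : UnitaryOperator H K, ∀ A : 𝒜,
      (φ A : K →L[ℂ] K) = unitaryConj U (A : H →L[ℂ] H)) ∨
    (∃ U : AntiunitaryOperator H K, ∀ A : 𝒜,
      (φ A : K →L[ℂ] K) = antiunitaryConj U (A : H →L[ℂ] H)) ∨
    (∃ U : UnitaryOperator H K, ∀ A : 𝒜,
      (φ A : K →L[ℂ] K) = unitaryConj U (ContinuousLinearMap.adjoint (A : H →L[ℂ] H))) ∨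
    (∃ U : AntiunitaryOperator H K, ∀ A : 𝒜,
      (φ A : K →L[ℂ] K) =
        antiunitaryConj U (ContinuousLinearMap.adjoint (A : H →L[ℂ] H))) := by
  classical
  let e : 𝒜 ≃ ℬ := Equiv.ofBijective φ hφ
  -- The value `0` off the algebra is never used; the extension avoids computing in subtypes.
  let f : (H →L[ℂ] H) → (K →L[ℂ] K) := fun A => if hA : A ∈ 𝒜 then φ ⟨A, hA⟩ else 0
  let g : (K →L[ℂ] K) → (H →L[ℂ] H) := fun B => if hB : B ∈ ℬ then e.symm ⟨B, hB⟩ else 0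
  have hf : ∀ A (hA : A ∈ 𝒜), f A = φ ⟨A, hA⟩ := fun A hA => dif_pos hA
  have hg : ∀ B (hB : B ∈ ℬ), g B = e.symm ⟨B, hB⟩ := fun B hB => dif_pos hB
  have h : IsJordanStarIso 𝒜 ℬ f g :=
    { rankOne_mem := h𝒜.rankOne_mem
      rankOne_mem' := hℬ.rankOne_mem
      map_mem := fun A hA => by rw [hf A hA]; exact (φ ⟨A, hA⟩).2
      inv_mem := fun B hB => by rw [hg B hB]; exact (e.symm ⟨B, hB⟩).2
      left_inv := fun A hA => by
        rw [hf A hA, hg _ (φ ⟨A, hA⟩).2]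
        exact congrArg Subtype.val (e.symm_apply_apply ⟨A, hA⟩)
      right_inv := fun B hB => by
        rw [hg B hB, hf _ (e.symm ⟨B, hB⟩).2]
        exact congrArg Subtype.val (e.apply_symm_apply ⟨B, hB⟩)
      map_star := fun A hA => by
        rw [hf A hA, hf _ (star_mem hA)]
        exact congrArg Subtype.val (hstar ⟨A, hA⟩)
      map_jmul := fun A hA B hB => by
        rw [hf A hA, hf B hB, hf _ (jmul_mem hA hB)]
        exact congrArg Subtype.val (hjordan ⟨A, hA⟩ ⟨B, hB⟩) }
  obtain ⟨x, x', hx, -⟩ := h.exists_mapsLine_pair hH 0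
  rcases h.map_rankOne_type hH hx with hu | hv
  · have hx' : MapsLine (fun A => f (star A)) x x' :=
      ⟨hx.norm_left, hx.norm_right, by rw [star_rankOne, hx.map_eq]⟩
    obtain ⟨σ, hσ⟩ := h.comp_star.exists_actsOnScalars
    -- Composing with the adjoint turns `f(y ⊗ x*) x' = 0` into the condition on adjoints required
    -- for the construction of `U`.
    have := h.comp_star.exists_unitary_or_antiunitary hH hσ hx' fun y hy => by
      rw [← h.comp_star.map_star _ (h.rankOne_mem y x), star_star, hu y hy]
    have key : ∀ A : 𝒜, (φ A : K →L[ℂ] K) =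
        f (star (ContinuousLinearMap.adjoint (A : H →L[ℂ] H))) := fun A => by
      rw [← ContinuousLinearMap.star_eq_adjoint, star_star, hf _ A.2]
    right; right
    refine this.imp ?_ ?_ <;> rintro ⟨U, hU⟩ <;> refine ⟨U, fun A => ?_⟩ <;>
      exact (key A).trans (hU _ (star_mem A.2))
  · obtain ⟨σ, hσ⟩ := h.exists_actsOnScalars
    rcases h.exists_unitary_or_antiunitary hH hσ hx hv with ⟨U, hU⟩ | ⟨U, hU⟩
    · exact Or.inl ⟨U, fun A => by rw [← hU _ A.2, hf _ A.2]⟩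
    · exact Or.inr (Or.inl ⟨U, fun A => by rw [← hU _ A.2, hf _ A.2]⟩)
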